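/- Let $K$ be a field, let $n>1$ be an integer, and let $V$ be a set of (normalized) discrete valuations $v\colon K^\times\to\mathbb Z$ of $K$; denote by $\mathcal O_{K,v}$ and $\overline K_v$ the valuation ring and the residue field of $v$. Assume that (A) for every $a\in K^\times$ the set $\{v\in V : v(a)\neq 0\}$ is finite; (B) there is a finite subset $V'\subset V$ such that the field of fractions of $\mathcal O:=\bigcap_{v\in V\setminus V'}\mathcal O_{K,v}$ coincides with $K$ (the empty intersection being $K$); (C) for every $v\in V$, the characteristic of $\overline K_v$ is $0$ or is prime to $n$. Let ${}_n\mathrm{Br}(K)$ be the $n$-torsion of the Brauer group of $K$. For $v\in V$ let $\mathcal G^{(v)}$ be the absolute Galois group of $\overline K_v$ and let $$\rho_v\colon {}_n\mathrm{Br}(K)\to \mathrm{Hom}(\mathcal G^{(v)},\mathbb Z/n\mathbb Z)$$ be the residue map with values in continuous homomorphisms. It is given as follows: if $L/K_v$ is a finite unramified Galois extension, with group $G$, of the completion of $K$ at $v$ which splits $\alpha$, then $\rho_v(\alpha)$ is the image of $\alpha\otimes_K K_v\in H^2(G,L^\times)$ under $$H^2(G,L^\times)\to H^2(G,\mathbb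 Z)\simeq \mathrm{Hom}(G,\mathbb Q/\mathbb Z)\to \mathrm{Hom}(\mathcal G^{(v)},\mathbb Q/\mathbb Z),$$ where the first map is induced by the extension of $v$ to $L$, the second is the inverse of the connecting map, the third is inflation, and $\mathbb Z/n\mathbb Z$ is identified with $\tfrac1n\mathbb Z/\mathbb Z$. Then for every $\alpha\in{}_n\mathrm{Br}(K)$ the set $$\mathrm{Ram}_V(\alpha)=\{v\in V : \rho_v(\alpha)\neq 1\}$$ of places in $V$ at which $\alpha$ is ramified is finite. -/

import Mathlib

open scoped WithZero TensorProduct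

universe u

noncomputable section

namespace BrauerRamification

variable {K : Type u} [Field K]

/-- The residue field `K̄_v` of a valuation `v` of `K`. -/
abbrev ResField (v : Valuation K ℤᵐ⁰) : Type u :=
  IsLocalRing.ResidueField v.valuationSubring

/-- The absolute Galois group `𝒢^(v)` of the residue field `K̄_v`, with its Krull topology. -/
abbrev ResGal (v : Valuation K ℤᵐ⁰) : Type u :=
  AlgebraicClosure (ResField v) ≃ₐ[ResField v] AlgebraicClosure (ResField v)

instance instUniformContinuousConstSMul (v : Valuation K ℤᵐ⁰) :
    UniformContinuousConstSMul K (WithVal v) where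
  uniformContinuous_const_smul x := by
    simpa [Algebra.smul_def] using
      uniformContinuous_const_smul (M := WithVal v) (X := WithVal v)
        (algebraMap K (WithVal v) x)

/-- The completion `K_v` is a `K`-algebra through the canonical embedding `K → K_v`. -/
instance instAlgebraCompletion (v : Valuation K ℤᵐ⁰) : Algebra K v.Completion :=
  inferInstanceAs (Algebra K (UniformSpace.Completion (WithVal v)))

/-- The valuation ring of the completion `K_v`. -/
abbrev ComplInt (v : Valuation K ℤᵐ⁰) : ValuationSubring v.Completion :=
  (Valued.v : Valuation v.Completion ℤᵐ⁰).valuationSubring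

/-- The `n`-torsion `ₙBr(K)`: the classes of central simple algebras `A` whose `n`-fold tensor
power `A ⊗ ⋯ ⊗ A` over `K` is split, that is, isomorphic to a matrix algebra over `K`. -/
def torsionBr (K : Type u) [Field K] (n : ℕ) : Set (BrauerGroup.{u, u} K) :=
  {α | ∃ A : CSA.{u, u} K, Quotient.mk (Brauer.CSA_Setoid K) A = α ∧
    ∃ r : ℕ, r ≠ 0 ∧
      Nonempty ((⨂[K] _ : Fin n, (A : Type u)) ≃ₐ[K] Matrix (Fin r) (Fin r) K)}

/-- For a finite extension `L` of the completion `K_v`, the unique extension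
`w : Lˣ → ℚ` of the (additively written) valuation `v`, namely
`w a = v (N_{L/K_v} a) / [L : K_v]`. When `L/K_v` is unramified, its values are integers. -/
def extVal (v : Valuation K ℤᵐ⁰) (L : IntermediateField v.Completion
    (AlgebraicClosure v.Completion)) (a : Lˣ) : ℚ :=
  -((WithZero.log (Valued.v (Algebra.norm v.Completion (a : L))) : ℤ) : ℚ) /
    (Module.finrank v.Completion L : ℚ)

/-- A finite extension `L` of the completion `K_v` (inside a fixed algebraic closure) that is
Galois and unramified: the integral closure of the valuation ring of `K_v` in `L` is unramified
over that valuation ring. -/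
structure IsUnramifiedGalois (v : Valuation K ℤᵐ⁰)
    (L : IntermediateField v.Completion (AlgebraicClosure v.Completion)) : Prop where
  finite : FiniteDimensional v.Completion L
  galois : IsGalois v.Completion L
  unramified : Algebra.FormallyUnramified (ComplInt v) (integralClosure (ComplInt v) L)

/-- For a tower `L/F/K` of fields with `L/F` Galois and a central simple `K`-algebra `A`:
the algebra `A` is split by `L`, and the resulting Galois descent of `A ⊗_K F` is described by the
`2`-cocycle `a` of `Gal(L/F)` with values in `Lˣ`. In detail: there are an isomorphism
`φ : L ⊗ A ≃ M_m(L)` and matrices `c σ ∈ GL_m(L)` such that `φ ∘ (σ ⊗ 1) = Int (c σ) ∘ σ ∘ φ` and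
`c σ * σ (c τ) = a σ τ • c (σ τ)`; the class of `a` in `H²(Gal(L/F), Lˣ)` is the class of
`A ⊗_K F` in `Br(L/F)`. -/
def HasCocycle (K F L A : Type u) [Field K] [Field F] [Field L] [Algebra K F] [Algebra F L]
    [Algebra K L] [IsScalarTower K F L] [Ring A] [Algebra K A]
    (a : (L ≃ₐ[F] L) → (L ≃ₐ[F] L) → Lˣ) : Prop :=
  ∃ (m : ℕ) (φ : (L ⊗[K] A) ≃ₐ[L] Matrix (Fin m) (Fin m) L)
    (c : (L ≃ₐ[F] L) → GL (Fin m) L),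
    (∀ (σ : L ≃ₐ[F] L) (x : L ⊗[K] A),
      φ (Algebra.TensorProduct.map ((σ : L →ₐ[F] L).restrictScalars K) (AlgHom.id K A) x) =
        (c σ).val * (φ x).map σ * (c σ)⁻¹.val) ∧
    ∀ σ τ : L ≃ₐ[F] L, (c σ).val * (c τ).val.map σ = (a σ τ : L) • (c (σ * τ)).val

/-- An embedding of the residue field of `L` into the algebraic closure of `K̄_v`, given as a ring
homomorphism on the integers of `L` that is the reduction map on the valuation ring of `v`. -/
def IsResidueEmbedding (v : Valuation K ℤᵐ⁰)
    (L : IntermediateField v.Completion (AlgebraicClosure v.Completion))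
    (ι : integralClosure (ComplInt v) L →+* AlgebraicClosure (ResField v)) : Prop :=
  ∀ (x : v.valuationSubring) (y : integralClosure (ComplInt v) L),
    (y : L) = algebraMap K L (x : K) →
      ι y = algebraMap (ResField v) (AlgebraicClosure (ResField v))
        (IsLocalRing.residue v.valuationSubring x)

/-- The automorphisms `σ` of `L/K_v` and `g ∈ 𝒢^(v)` induce the same automorphism of the residue
field of `L`, viewed inside the algebraic closure of `K̄_v` through `ι`. -/
def SameReduction (v : Valuation K ℤᵐ⁰)
    (L : IntermediateField v.Completion (AlgebraicClosure v.Completion))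
    (ι : integralClosure (ComplInt v) L →+* AlgebraicClosure (ResField v))
    (σ : L ≃ₐ[v.Completion] L) (g : ResGal v) : Prop :=
  ∀ y z : integralClosure (ComplInt v) L, (z : L) = σ (y : L) → ι z = g (ι y)

/-- The graph of the residue map `ρ_v : ₙBr(K) → Hom(𝒢^(v), ℤ/nℤ)` (continuous homomorphisms):
`χ` is the residue at `v` of the class `α`. This is the composite
`Br(L/K_v) = H²(G, Lˣ) → H²(G, ℤ) ≃ H¹(G, ℚ/ℤ) = Hom(G, ℚ/ℤ) → Hom(𝒢^(v), ℚ/ℤ)`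
for an unramified finite Galois extension `L/K_v` with group `G` that splits `α`. The first arrow
is induced by the valuation `w` of `L`; the second is the inverse of the connecting map, so it
sends the class of `δf`, where `f : G → ℚ` and `δf (σ, τ) = f σ + f τ - f (σ τ)` is integral, to
`f mod ℤ`; the last is inflation along `𝒢^(v) → Gal(l/K̄_v) ≃ G`, `l` being the residue field of
`L`. The group `ℤ/nℤ` is identified with `(1/n)ℤ/ℤ ⊂ ℚ/ℤ`. Neither the choice of `A`, `L`, `a`,
`f` nor that of the embedding `ι`, which always exists, affects `χ`. -/
def IsResidue (v : Valuation K ℤᵐ⁰) (n : ℕ) (α : BrauerGroup.{u, u} K)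
    (χ : ResGal v →ₜ* Multiplicative (ZMod n)) : Prop :=
  ∃ (A : CSA.{u, u} K) (L : IntermediateField v.Completion (AlgebraicClosure v.Completion))
    (a : (L ≃ₐ[v.Completion] L) → (L ≃ₐ[v.Completion] L) → Lˣ)
    (f : (L ≃ₐ[v.Completion] L) → ℚ),
    Quotient.mk (Brauer.CSA_Setoid K) A = α ∧
    IsUnramifiedGalois v L ∧
    HasCocycle K v.Completion L A a ∧
    (∀ σ τ, extVal v L (a σ τ) = f σ + f τ - f (σ * τ)) ∧
    ∀ ι, IsResidueEmbedding v L ι → ∀ σ g, SameReduction v L ι σ g →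
      ∃ z : ℤ, f σ = ((χ g).toAdd.val : ℚ) / (n : ℚ) + (z : ℚ)

/-- `Ram_V(α)`: the set of those `v ∈ V` at which the residue of `α` is not trivial. -/
def Ram (V : Set (Valuation K ℤᵐ⁰)) (n : ℕ) (α : BrauerGroup.{u, u} K) :
    Set (Valuation K ℤᵐ⁰) :=
  {v ∈ V | ¬ IsResidue v n α 1}

end BrauerRamification

end

/-! A single finite set of data over `K` controls the ramification of a class at every place. A
central simple algebra `A` representing the class is split by a finite Galois extension `M = K(θ)`,
and descent attaches to it a cocycle `b` with finitely many values in `Mˣ`. By (A), for almost all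
`v` the following have `v`-integral coefficients: the minimal polynomial `p` of `θ`, a polynomial
`g` with `g(θ) p'(θ) = 1`, and the minimal polynomials of the values of `b` and of their inverses.
At such a `v`, `p'(θ)` is a unit in `O_v[θ]`, so `L = K_v(θ)` is Galois and unramified over `K_v`
(`formallyUnramified_integralClosure`). It splits `A`, with cocycle obtained from `b` by restricting
automorphisms to `M` (`HasCocycle.baseChange`). The values of that cocycle are units, so their
valuations vanish (`extVal_eq_zero`) and the residue is trivial. -/

/-! ### Central simple algebras under base change -/

section CentralSimple

variable (K A : Type*) [Field K] [Ring A] [Algebra K A]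

/-- Submodules of `A` over `A ⊗ Aᵐᵒᵖ` are two-sided ideals, so `A` is a simple module. Its
endomorphisms commute with left and right multiplications, hence are scalars from the centre `K`.
Jacobson density on a basis does the rest. -/
theorem mulLeftRight_surjective [Algebra.IsCentral K A] [IsSimpleRing A] [FiniteDimensional K A] :
    Function.Surjective (AlgHom.mulLeftRight K A) := by
  let : Module (A ⊗[K] Aᵐᵒᵖ) A := TensorProduct.Algebra.module
  have hsmul (a b x : A) : (a ⊗ₜ[K] MulOpposite.op b) • x = a * x * b := by
    rw [TensorProduct.Algebra.smul_def]; simp [mul_assoc]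
  have hsmul' (t : A ⊗[K] Aᵐᵒᵖ) (x : A) : t • x = AlgHom.mulLeftRight K A t x := rfl
  have : IsSimpleModule (A ⊗[K] Aᵐᵒᵖ) A := by
    rw [isSimpleModule_iff]
    refine { eq_bot_or_eq_top := fun N ↦ ?_ }
    let I : Ideal A :=
      { N.toAddSubmonoid with
        smul_mem' := fun a x hx ↦ by
          have := N.smul_mem (a ⊗ₜ[K] MulOpposite.op 1) hx
          rwa [hsmul, mul_one] at this }
    have hI : I.IsTwoSided := ⟨fun {x} b hx ↦ by
      have := N.smul_mem (1 ⊗ₜ[K] MulOpposite.op b) (show x ∈ N from hx)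
      rwa [hsmul, one_mul] at this⟩
    have hIN (x : A) : x ∈ I ↔ x ∈ N := Iff.rfl
    rcases (isSimpleRing_iff_isTwoSided_imp.mp ‹_›).2 I hI with h | h
    · exact .inl (by ext x; rw [← hIN, h]; simp)
    · exact .inr (by ext x; rw [← hIN, h]; simp)
  have hEnd (g : Module.End (A ⊗[K] Aᵐᵒᵖ) A) : ∃ k : K, ∀ x, g x = k • x := by
    have hl (a : A) : g a = a * g 1 := by
      have := g.map_smul (a ⊗ₜ[K] MulOpposite.op 1) 1
      rwa [hsmul, hsmul, mul_one, mul_one, mul_one] at this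
    have hr (a : A) : g a = g 1 * a := by
      have := g.map_smul (1 ⊗ₜ[K] MulOpposite.op a) 1
      rwa [hsmul, hsmul, one_mul, one_mul, one_mul] at this
    have hc : g 1 ∈ Subalgebra.center K A :=
      Subalgebra.mem_center_iff.mpr fun b ↦ by rw [← hl, ← hr]
    obtain ⟨k, hk⟩ := Algebra.mem_bot.mp (Algebra.IsCentral.out hc)
    exact ⟨k, fun x ↦ by rw [hr, ← hk, Algebra.smul_def]⟩
  intro T
  classical
  let f : Module.End (Module.End (A ⊗[K] Aᵐᵒᵖ) A) A :=
    { toFun := T, map_add' := T.map_add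
      map_smul' := fun g x ↦ by
        obtain ⟨k, hk⟩ := hEnd g
        simp [hk] }
  obtain ⟨r, hr⟩ := jacobson_density f (Finset.univ.image (Module.finBasis K A))
  refine ⟨r, (Module.finBasis K A).ext fun i ↦ ?_⟩
  rw [← hsmul', ← hr _ (by simp)]
  rfl

variable (F : Type*) [Field F] [Algebra K F]

theorem lTensor_mulLeftRight_tmul (a b : A) (x : F ⊗[K] A) :
    (AlgHom.mulLeftRight K A (a ⊗ₜ MulOpposite.op b)).lTensor F x =
      (1 ⊗ₜ a) * x * (1 ⊗ₜ b) := by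
  induction x with
  | zero => simp
  | tmul f y => simp
  | add x y hx hy => simp [hx, hy, mul_add, add_mul]

variable [Algebra.IsCentral K A] [IsSimpleRing A] [FiniteDimensional K A]

/-- Every `K`-endomorphism of `A` is a sum of maps `x ↦ a x b`, so ideals of `F ⊗ A` are stable
under `1 ⊗ T`. Taking for `T` a coordinate function produces a unit of `F` from a nonzero element.
-/
theorem isSimpleRing_tensorProduct : IsSimpleRing (F ⊗[K] A) := by
  rw [isSimpleRing_iff_isTwoSided_imp]
  refine ⟨inferInstance, fun I hI ↦ or_iff_not_imp_left.mpr fun hne ↦ ?_⟩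
  have hstab (T : Module.End K A) (x) (hx : x ∈ I) : T.lTensor F x ∈ I := by
    obtain ⟨t, rfl⟩ := mulLeftRight_surjective K A T
    induction t with
    | zero => simp
    | tmul a b =>
      rw [← MulOpposite.op_unop b, lTensor_mulLeftRight_tmul]
      exact I.mul_mem_right _ (I.mul_mem_left _ hx)
    | add s t hs ht => simpa [LinearMap.lTensor_add] using I.add_mem hs ht
  obtain ⟨x, hxI, hx0⟩ := Submodule.exists_mem_ne_zero_of_ne_bot hne
  let b := Module.finBasis K A
  let B := b.baseChange F
  obtain ⟨i, hi⟩ : ∃ i, B.repr x i ≠ 0 := by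
    by_contra! h
    exact hx0 (B.repr.map_eq_zero_iff.mp (Finsupp.ext h))
  have key (y : F ⊗[K] A) :
      ((b.coord i).smulRight (1 : A)).lTensor F y = B.repr y i ⊗ₜ 1 := by
    induction y with
    | zero => simp
    | tmul f a =>
      simp only [LinearMap.lTensor_tmul, LinearMap.smulRight_apply, TensorProduct.tmul_smul, B,
        Module.Basis.baseChange_repr_tmul, Module.Basis.coord_apply, TensorProduct.smul_tmul']
    | add x y hx hy => simp [hx, hy, TensorProduct.add_tmul]
  have := I.mul_mem_left ((B.repr x i)⁻¹ ⊗ₜ 1) (hstab ((b.coord i).smulRight (1 : A)) x hxI)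
  rw [key, Algebra.TensorProduct.tmul_mul_tmul, inv_mul_cancel₀ hi, one_mul,
    ← Algebra.TensorProduct.one_def] at this
  exact (Ideal.eq_top_iff_one I).mpr this

theorem isCentral_tensorProduct : Algebra.IsCentral F (F ⊗[K] A) := by
  refine ⟨fun z hz ↦ ?_⟩
  rw [Subalgebra.mem_center_iff] at hz
  have hmul (T : Module.End K A) : T.lTensor F z = z * (1 ⊗ₜ T 1) := by
    obtain ⟨t, rfl⟩ := mulLeftRight_surjective K A T
    induction t with
    | zero => simp
    | tmul a b =>
      rw [← MulOpposite.op_unop b, lTensor_mulLeftRight_tmul, hz]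
      simp [mul_assoc]
    | add s t hs ht => simp [LinearMap.lTensor_add, hs, ht, TensorProduct.tmul_add, mul_add]
  -- With `l 1 = 1` and `T = l(·) 1`, the identity `hmul` reads `(1 ⊗ T) z = z`, and its left side
  -- lies in `F ⊗ 1`.
  obtain ⟨l, hl⟩ := Module.Projective.exists_dual_eq_one K (one_ne_zero (α := A))
  have h1 := hmul (l.smulRight (1 : A))
  have key (y : F ⊗[K] A) : ∃ f : F, (l.smulRight (1 : A)).lTensor F y = f ⊗ₜ 1 := by
    induction y with
    | zero => exact ⟨0, by simp⟩
    | tmul f a => exact ⟨l a • f, by simp [TensorProduct.smul_tmul]⟩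
    | add x y hx hy =>
      obtain ⟨f, hf⟩ := hx
      obtain ⟨g, hg⟩ := hy
      exact ⟨f + g, by simp [hf, hg, TensorProduct.add_tmul]⟩
  obtain ⟨f, hf⟩ := key z
  refine Algebra.mem_bot.mpr ⟨f, ?_⟩
  rw [hf] at h1
  simpa [hl, ← Algebra.TensorProduct.one_def] using h1

end CentralSimple

/-! ### Splitting by a finite Galois extension -/

/-- By Jacobson–Noether, a larger `D` would contain a noncentral separable element, whose minimal
polynomial over `F` has degree one. -/
theorem IsSepClosed.algebraMap_surjective_of_isCentral (F D : Type*) [Field F] [IsSepClosed F]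
    [DivisionRing D] [Algebra F D] [Algebra.IsAlgebraic F D] [Algebra.IsCentral F D] :
    Function.Surjective (algebraMap F D) := by
  suffices h : (⊥ : Subalgebra F D) = ⊤ from fun x ↦ Algebra.mem_bot.mp (h ▸ Algebra.mem_top)
  by_contra hne
  obtain ⟨x, hx, hsep⟩ := JacobsonNoether.exists_separable_and_not_isCentral' hne
  have hint : IsIntegral F x := Algebra.IsIntegral.isIntegral x
  exact hx (Algebra.mem_bot.mpr (minpoly.mem_range_of_degree_eq_one F x
    (IsSepClosed.degree_eq_one_of_irreducible F (minpoly.irreducible hint) hsep)))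

theorem exists_algEquiv_matrix_of_isSepClosed (F B : Type*) [Field F] [IsSepClosed F]
    [Ring B] [Algebra F B] [Algebra.IsCentral F B] [IsSimpleRing B] [FiniteDimensional F B] :
    ∃ n : ℕ, n ≠ 0 ∧ Nonempty (B ≃ₐ[F] Matrix (Fin n) (Fin n) F) := by
  have := IsArtinianRing.of_finite F B
  obtain ⟨n, hn, D, _, _, _, ⟨e⟩⟩ := IsSimpleRing.exists_algEquiv_matrix_divisionRing_finite F B
  have : Algebra.IsCentral F (Matrix (Fin n) (Fin n) D) := Algebra.IsCentral.of_algEquiv F _ _ e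
  have : Algebra.IsCentral F D := by
    refine ⟨fun d hd ↦ ?_⟩
    rw [Subalgebra.mem_center_iff] at hd
    have : Matrix.scalar (Fin n) d ∈ Subalgebra.center F (Matrix (Fin n) (Fin n) D) :=
      Subalgebra.mem_center_iff.mpr fun M ↦ (Matrix.scalar_commute d (fun r ↦ (hd r).symm) M).symm.eq
    obtain ⟨f, hf⟩ := Algebra.mem_bot.mp (Algebra.IsCentral.out this)
    refine Algebra.mem_bot.mpr ⟨f, ?_⟩
    have := congr($hf 0 0)
    simpa [Matrix.algebraMap_matrix_apply] using this
  exact ⟨n, NeZero.ne n, ⟨e.trans (.mapMatrix (.symm (.ofBijective (Algebra.ofId F D)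
    ⟨(algebraMap F D).injective, IsSepClosed.algebraMap_surjective_of_isCentral F D⟩)))⟩⟩

theorem Matrix.mem_range_of_finrank_le {M Fs : Type*} [Field M] [Field Fs] [Algebra M Fs] (n : ℕ)
    (S : Subalgebra M (Matrix (Fin n) (Fin n) Fs)) [FiniteDimensional M S]
    (hS : ∀ i j, Matrix.single i j (1 : Fs) ∈ S) (hn : Module.finrank M S ≤ n * n) :
    S = (AlgHom.mapMatrix (m := Fin n) (Algebra.ofId M Fs)).range := by
  symm
  apply Subalgebra.toSubmodule_injective
  have : FiniteDimensional M (Subalgebra.toSubmodule S) := ‹FiniteDimensional M S›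
  refine Submodule.eq_of_le_of_finrank_le ?_ ?_
  · rintro _ ⟨x, rfl⟩
    change _ ∈ S
    rw [Matrix.matrix_eq_sum_single x]
    simp only [map_sum]
    refine sum_mem fun i _ ↦ sum_mem fun j _ ↦ ?_
    convert S.smul_mem (hS i j) (x i j)
    ext a b
    simp [Matrix.single_apply, Algebra.ofId_apply, Algebra.smul_def, apply_ite (algebraMap M Fs)]
  · refine (show _ ≤ n * n from hn).trans ?_
    have hinj : Function.Injective (AlgHom.mapMatrix (m := Fin n) (Algebra.ofId M Fs)) :=
      fun x y h ↦ Matrix.map_injective (algebraMap M Fs).injective h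
    have := (AlgEquiv.ofInjective _ hinj).toLinearEquiv.finrank_eq
    rw [Module.finrank_matrix] at this
    simp at this
    exact this.le

/-- The image of `M ⊗ A` in the matrices over `Fs` contains all matrix units and has `M`-dimension
`n²`, so it is exactly the matrices over `M`. -/
theorem nonempty_algEquiv_matrix_of_single_mem {K M Fs A : Type*} [Field K] [Field M] [Field Fs]
    [Ring A] [Algebra K A] [FiniteDimensional K A] [Algebra K M] [Algebra K Fs] [Algebra M Fs]
    [IsScalarTower K M Fs] {n : ℕ} (e : Fs ⊗[K] A ≃ₐ[Fs] Matrix (Fin n) (Fin n) Fs)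
    (h : ∀ i j, e.symm (Matrix.single i j 1) ∈
      (Algebra.TensorProduct.map (Algebra.ofId M Fs) (AlgHom.id K A)).range) :
    Nonempty (M ⊗[K] A ≃ₐ[M] Matrix (Fin n) (Fin n) M) := by
  let ψ : M ⊗[K] A →ₐ[M] Fs ⊗[K] A :=
    Algebra.TensorProduct.map (Algebra.ofId M Fs) (AlgHom.id K A)
  have hψ : Function.Injective ψ :=
    Module.Flat.rTensor_preserves_injective_linearMap (M := A)
      ((IsScalarTower.toAlgHom K M Fs).toLinearMap) (algebraMap M Fs).injective
  let θ : M ⊗[K] A →ₐ[M] Matrix (Fin n) (Fin n) Fs := (e.toAlgHom.restrictScalars M).comp ψ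
  have hθ : Function.Injective θ := e.injective.comp hψ
  have hmem (i j : Fin n) : Matrix.single i j (1 : Fs) ∈ θ.range := by
    obtain ⟨y, hy⟩ := h i j
    refine ⟨y, ?_⟩
    change e (ψ y) = _
    exact (congrArg e hy).trans (e.apply_symm_apply _)
  let E := AlgEquiv.ofInjective θ hθ
  have : FiniteDimensional M θ.range := Module.Finite.equiv E.toLinearEquiv
  have hrank : Module.finrank M θ.range = n * n := by
    rw [← E.toLinearEquiv.finrank_eq, Module.finrank_baseChange,
      ← Module.finrank_baseChange (R := Fs), e.toLinearEquiv.finrank_eq, Module.finrank_matrix]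
    simp
  have hrange := Matrix.mem_range_of_finrank_le n θ.range hmem hrank.le
  have hinj : Function.Injective (AlgHom.mapMatrix (m := Fin n) (Algebra.ofId M Fs)) :=
    fun x y h ↦ Matrix.map_injective (algebraMap M Fs).injective h
  exact ⟨(E.trans (Subalgebra.equivOfEq _ _ hrange)).trans (AlgEquiv.ofInjective _ hinj).symm⟩

/-- The separable closure splits `A`. The preimages of the `n²` matrix units involve only finitely
many of its elements, and the normal closure of the field these generate is enough. -/
theorem exists_galois_splitting (K : Type u) (A : Type*) [Field K] [Ring A] [Algebra K A]
    [Algebra.IsCentral K A] [IsSimpleRing A] [FiniteDimensional K A] :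
    ∃ (M : Type u) (_ : Field M) (_ : Algebra K M) (n : ℕ), FiniteDimensional K M ∧ IsGalois K M ∧
      n ≠ 0 ∧ Nonempty (M ⊗[K] A ≃ₐ[M] Matrix (Fin n) (Fin n) M) := by
  let Fs := SeparableClosure K
  have := isSimpleRing_tensorProduct K A Fs
  have := isCentral_tensorProduct K A Fs
  obtain ⟨n, hn, ⟨e⟩⟩ := exists_algEquiv_matrix_of_isSepClosed Fs (Fs ⊗[K] A)
  obtain ⟨N, hN, hNS⟩ := TensorProduct.exists_finite_submodule_left_of_setFinite
    (Set.range fun p : Fin n × Fin n ↦ e.symm (Matrix.single p.1 p.2 1)) (Set.finite_range _)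
  obtain ⟨s, hs⟩ := Module.Finite.iff_fg.mp hN
  let M₀ : IntermediateField K Fs := .adjoin K s
  have : FiniteDimensional K M₀ :=
    IntermediateField.finiteDimensional_adjoin fun x _ ↦ Algebra.IsIntegral.isIntegral x
  let M := IntermediateField.normalClosure K M₀ Fs
  have hM₀M : M₀ ≤ M := IntermediateField.le_normalClosure M₀
  have hNM : N ≤ Subalgebra.toSubmodule M.toSubalgebra := by
    rw [← hs, Submodule.span_le]
    exact fun x hx ↦ hM₀M (IntermediateField.subset_adjoin K _ hx)
  refine ⟨M, inferInstance, inferInstance, n, inferInstance, ⟨⟩, hn,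
    nonempty_algEquiv_matrix_of_single_mem e fun i j ↦ ?_⟩
  obtain ⟨y, hy⟩ := hNS ⟨(i, j), rfl⟩
  refine ⟨(Submodule.inclusion hNM).rTensor A y, ?_⟩
  refine Eq.trans ?_ hy
  clear hy
  induction y with
  | zero => simp
  | tmul f a => rfl
  | add x y hx hy => simp only [map_add] at hx hy ⊢; rw [hx, hy]

/-! ### Skolem–Noether and descent cocycles -/

theorem Matrix.exists_conj_of_algEquiv {M : Type*} [Field M] {n : ℕ}
    (f : Matrix (Fin n) (Fin n) M ≃ₐ[M] Matrix (Fin n) (Fin n) M) :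
    ∃ g : GL (Fin n) M, ∀ x, f x = g.val * x * g⁻¹.val := by
  let E : Matrix (Fin n) (Fin n) M ≃ₐ[M] Module.End M (Fin n → M) := Matrix.toLinAlgEquiv'
  obtain ⟨T, hT⟩ := AlgEquiv.eq_linearEquivConjAlgEquiv ((E.symm.trans f).trans E)
  let u : (Module.End M (Fin n → M))ˣ :=
    ⟨T.toLinearMap, T.symm.toLinearMap, by ext; simp, by ext; simp⟩
  refine ⟨Units.map E.symm.toAlgHom.toMonoidHom u, fun x ↦ E.injective ?_⟩
  have h := congr($hT (E x))
  have hu : (Units.map E.symm.toAlgHom.toMonoidHom u)⁻¹.val = E.symm T.symm.toLinearMap := rfl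
  have hu' : (Units.map E.symm.toAlgHom.toMonoidHom u).val = E.symm T.toLinearMap := rfl
  rw [hu, hu', map_mul, map_mul, AlgEquiv.apply_symm_apply, AlgEquiv.apply_symm_apply]
  rw [AlgEquiv.trans_apply, AlgEquiv.trans_apply, AlgEquiv.symm_apply_apply] at h
  rw [h]
  rfl

theorem Matrix.exists_eq_smul_of_conj_eq {M : Type*} [Field M] {n : ℕ} (hn : n ≠ 0)
    (C D : GL (Fin n) M) (h : ∀ x : Matrix (Fin n) (Fin n) M,
      D.val * x * D⁻¹.val = C.val * x * C⁻¹.val) :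
    ∃ r : Mˣ, D.val = (r : M) • C.val := by
  have : NeZero n := ⟨hn⟩
  have hc : (C⁻¹ * D).val ∈ Subalgebra.center M (Matrix (Fin n) (Fin n) M) := by
    refine Subalgebra.mem_center_iff.mpr fun x ↦ ?_
    have h1 := congr(C⁻¹.val * $(h x) * D.val)
    simp only [mul_assoc, Units.inv_mul, mul_one] at h1
    rw [Units.inv_mul_cancel_left] at h1
    rw [Units.val_mul, mul_assoc, h1]
  obtain ⟨r, hr⟩ := Algebra.mem_bot.mp (Algebra.IsCentral.out hc)
  have hD : D.val = r • C.val := by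
    have := congr(C.val * $hr)
    rw [Units.val_mul, ← mul_assoc, ← Units.val_mul, mul_inv_cancel, Units.val_one, one_mul,
      ← Algebra.commutes, ← Algebra.smul_def] at this
    exact this.symm
  refine ⟨Units.mk0 r ?_, hD⟩
  rintro rfl
  rw [zero_smul] at hD
  exact D.ne_zero hD

namespace BrauerRamification

theorem exists_hasCocycle {K M A : Type u} [Field K] [Field M] [Ring A] [Algebra K M]
    [Algebra K A] {n : ℕ} (hn : n ≠ 0) (φ : M ⊗[K] A ≃ₐ[M] Matrix (Fin n) (Fin n) M) :
    ∃ b, HasCocycle K K M A b := by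
  let s (σ : M ≃ₐ[K] M) : M ⊗[K] A →ₐ[K] M ⊗[K] A :=
    Algebra.TensorProduct.map ((σ : M →ₐ[K] M).restrictScalars K) (AlgHom.id K A)
  have hc (σ : M ≃ₐ[K] M) : ∃ c : GL (Fin n) M, ∀ x,
      φ (s σ x) = c.val * (φ x).map σ * c⁻¹.val := by
    -- The composite `φ ∘ (σ ⊗ 1) ∘ φ⁻¹ ∘ σ⁻¹`: the two semilinearities cancel, so it is `M`-linear
    -- and therefore inner.
    let R : Matrix (Fin n) (Fin n) M ≃+* Matrix (Fin n) (Fin n) M :=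
      ((σ.symm.toRingEquiv.mapMatrix.trans φ.symm.toRingEquiv).trans
        (Algebra.TensorProduct.congr σ (AlgEquiv.refl (R := K) (A₁ := A))).toRingEquiv).trans
          φ.toRingEquiv
    have hR (x) : R (x.map σ) = φ (s σ (φ.symm x)) := by
      have : (x.map σ).map σ.symm = x := by ext; simp
      change φ (s σ (φ.symm ((x.map σ).map σ.symm))) = _
      rw [this]
    have hsc (r : M) : R (algebraMap M _ r) = algebraMap M _ r := by
      have h1 : algebraMap M (Matrix (Fin n) (Fin n) M) r =
          (algebraMap M (Matrix (Fin n) (Fin n) M) (σ.symm r)).map σ := by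
        ext i j
        simp [Matrix.algebraMap_matrix_apply, apply_ite σ]
      conv_lhs => rw [h1, hR, AlgEquiv.commutes, Algebra.TensorProduct.algebraMap_apply]
      rw [← φ.commutes, Algebra.TensorProduct.algebraMap_apply]
      simp [s]
    obtain ⟨c, hc⟩ := Matrix.exists_conj_of_algEquiv (AlgEquiv.ofRingEquiv (f := R) hsc)
    refine ⟨c, fun x ↦ ?_⟩
    rw [← hc]
    change _ = R _
    rw [hR, AlgEquiv.symm_apply_apply]
  choose c hc using hc
  have hb (σ τ : M ≃ₐ[K] M) : ∃ r : Mˣ, (c σ).val * (c τ).val.map σ = (r : M) • (c (σ * τ)).val := by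
    let G := Matrix.GeneralLinearGroup.map (n := Fin n) (σ : M →+* M)
    have hG (g) : (G g).val = g.val.map σ := rfl
    -- Both matrices describe the action of `στ`, so they induce the same conjugation and differ by
    -- a scalar.
    refine Matrix.exists_eq_smul_of_conj_eq hn (c (σ * τ)) (c σ * G (c τ)) fun y ↦ ?_
    obtain ⟨x, rfl⟩ : ∃ x, (φ x).map (σ * τ : M ≃ₐ[K] M) = y :=
      ⟨φ.symm (y.map (σ * τ : M ≃ₐ[K] M).symm), by
        ext i j
        rw [AlgEquiv.apply_symm_apply]
        exact (σ * τ : M ≃ₐ[K] M).apply_symm_apply _⟩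
    rw [← hc]
    have hs : s (σ * τ) x = s σ (s τ x) := by
      induction x with
      | zero => simp
      | tmul m a => rfl
      | add x y hx hy => simp only [map_add, hx, hy]
    have hmap (X Y : Matrix (Fin n) (Fin n) M) : (X * Y).map σ = X.map σ * Y.map σ :=
      Matrix.map_mul (f := (σ : M →+* M))
    rw [hs, hc, hc, mul_inv_rev, ← map_inv, Units.val_mul, Units.val_mul, hmap, hmap, hG, hG]
    have : (φ x).map (σ * τ : M ≃ₐ[K] M) = ((φ x).map τ).map σ := rfl
    rw [this]
    simp only [mul_assoc]
  choose b hb using hb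
  exact ⟨b, n, φ, c, hc, hb⟩

/-- The matrices `c` still work once their entries are read in `L`, since an automorphism of `L/F`
acts on them through its restriction to `M`. -/
theorem HasCocycle.baseChange {K F M L A : Type u} [Field K] [Field F] [Field M] [Field L]
    [Ring A] [Algebra K F] [Algebra F L] [Algebra K L] [IsScalarTower K F L] [Algebra K M]
    [Algebra M L] [IsScalarTower K M L] [Normal K M] [Algebra K A] [FiniteDimensional K A]
    {b : (M ≃ₐ[K] M) → (M ≃ₐ[K] M) → Mˣ} (h : HasCocycle K K M A b) :
    HasCocycle K F L A fun σ τ ↦ Units.map (algebraMap M L).toMonoidHom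
      (b ((σ.restrictScalars K).restrictNormal M) ((τ.restrictScalars K).restrictNormal M)) := by
  obtain ⟨m, φ, c, hc, hb⟩ := h
  let r (σ : L ≃ₐ[F] L) : M ≃ₐ[K] M := (σ.restrictScalars K).restrictNormal M
  have hr (σ x) : σ (algebraMap M L x) = algebraMap M L (r σ x) :=
    ((σ.restrictScalars K).restrictNormal_commutes M x).symm
  have hrmul (σ τ) : r (σ * τ) = r σ * r τ := by
    ext x
    apply (algebraMap M L).injective
    rw [← hr, AlgEquiv.mul_apply, AlgEquiv.mul_apply, hr, hr]
  let ι : Matrix (Fin m) (Fin m) M →ₐ[K] Matrix (Fin m) (Fin m) L :=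
    (IsScalarTower.toAlgHom K M L).mapMatrix
  let Φ₀ : L ⊗[K] A →ₐ[L] Matrix (Fin m) (Fin m) L :=
    Algebra.TensorProduct.lift (Algebra.ofId L _)
      (ι.comp ((φ.toAlgHom.restrictScalars K).comp Algebra.TensorProduct.includeRight))
      fun l a ↦ Algebra.commutes l _
  have hΦ₀ (l : L) (a : A) : Φ₀ (l ⊗ₜ a) = l • (φ (1 ⊗ₜ a)).map (algebraMap M L) := by
    refine (Algebra.TensorProduct.lift_tmul _ _ _ _ _).trans ?_
    rw [Algebra.smul_def]
    rfl
  have hsurj : Function.Surjective Φ₀ := by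
    have hM (y : M ⊗[K] A) : (φ y).map (algebraMap M L) ∈ Φ₀.range := by
      induction y with
      | zero => simp
      | tmul t a =>
        refine ⟨algebraMap M L t ⊗ₜ a, (hΦ₀ _ _).trans ?_⟩
        have : t ⊗ₜ[K] a = t • (1 ⊗ₜ[K] a) := by simp [TensorProduct.smul_tmul']
        rw [this, map_smul]
        ext
        simp
      | add x y hx hy =>
        convert add_mem hx hy
        ext
        simp
    intro X
    rw [← AlgHom.mem_range, Matrix.matrix_eq_sum_single X]
    refine sum_mem fun i _ ↦ sum_mem fun j _ ↦ ?_
    convert Φ₀.range.smul_mem (hM (φ.symm (Matrix.single i j 1))) (X i j)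
    ext a b
    simp [Matrix.single_apply]
  have hrank : Module.finrank L (L ⊗[K] A) = Module.finrank L (Matrix (Fin m) (Fin m) L) := by
    rw [Module.finrank_baseChange, ← Module.finrank_baseChange (R := M),
      φ.toLinearEquiv.finrank_eq, Module.finrank_matrix, Module.finrank_matrix]
    simp
  let Φ : L ⊗[K] A ≃ₐ[L] Matrix (Fin m) (Fin m) L := AlgEquiv.ofBijective Φ₀
    ⟨(LinearMap.injective_iff_surjective_of_finrank_eq_finrank hrank (f := Φ₀.toLinearMap)).mpr
      hsurj, hsurj⟩
  have hΦ (l : L) (a : A) : Φ (l ⊗ₜ a) = l • (φ (1 ⊗ₜ a)).map (algebraMap M L) := hΦ₀ l a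
  let G := Matrix.GeneralLinearGroup.map (n := Fin m) (algebraMap M L)
  have hG (g) : (G g).val = g.val.map (algebraMap M L) := rfl
  have hmap (X Y : Matrix (Fin m) (Fin m) M) : (X * Y).map (algebraMap M L) =
      X.map (algebraMap M L) * Y.map (algebraMap M L) := Matrix.map_mul
  have hcomm (σ : L ≃ₐ[F] L) (X : Matrix (Fin m) (Fin m) M) : (X.map (algebraMap M L)).map σ =
      (X.map (r σ)).map (algebraMap M L) := by
    ext; simp [hr]
  refine ⟨m, Φ, fun σ ↦ G (c (r σ)), fun σ x ↦ ?_, fun σ τ ↦ ?_⟩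
  · induction x with
    | zero => simp
    | tmul l a =>
      have h1 := hc (r σ) (1 ⊗ₜ a)
      simp only [Algebra.TensorProduct.map_tmul, map_one, AlgHom.id_apply] at h1
      have h2 : (l • (φ (1 ⊗ₜ a)).map (algebraMap M L)).map σ =
          σ l • ((φ (1 ⊗ₜ a)).map (algebraMap M L)).map σ := by
        ext; simp
      rw [Algebra.TensorProduct.map_tmul, hΦ, hΦ, AlgHom.id_apply, h2, hcomm, Matrix.mul_smul,
        Matrix.smul_mul, ← map_inv, hG, hG, ← hmap, ← hmap, ← h1]
      rfl
    | add x y hx hy =>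
      have : (Φ x + Φ y).map σ = (Φ x).map σ + (Φ y).map σ := by ext; simp
      rw [map_add, map_add, hx, hy, map_add, this, mul_add, add_mul]
  · rw [hG, hG, hG, hcomm, ← hmap, hb, ← hrmul]
    ext
    simp [r]

end BrauerRamification

/-! ### Unramifiedness from an invertible derivative -/

-- Traces of integral elements lie in `O`, so the integral closure lies in the trace dual of `O[x]`,
-- which is `g'(x)⁻¹ O[x]` for `g` the minimal polynomial.
open Polynomial in
theorem integralClosure_eq_adjoin_of_mul_derivative_eq_one (O F : Type*) {L : Type u} [CommRing O]
    [Field F] [Field L] [Algebra O F] [Algebra F L] [Algebra O L] [IsScalarTower O F L]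
    [IsDomain O] [IsFractionRing O F] [IsIntegrallyClosed O] [FiniteDimensional F L]
    [Algebra.IsSeparable F L] {x u : L} {f : O[X]} (hf : f.Monic) (hfx : aeval x f = 0)
    (hx : Algebra.adjoin F {x} = ⊤) (hu : u ∈ Algebra.adjoin O {x})
    (hux : u * aeval x f.derivative = 1) :
    integralClosure O L = Algebra.adjoin O {x} := by
  have hxi : IsIntegral O x := ⟨f, hf, hfx⟩
  refine le_antisymm (fun y hy ↦ ?_) (adjoin_le_integralClosure hxi)
  have hdual : y ∈ (Algebra.traceForm F L).dualSubmodule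
      (Subalgebra.toSubmodule (Algebra.adjoin O {x})) := by
    rw [LinearMap.BilinForm.mem_dualSubmodule]
    intro z hz
    rw [Algebra.traceForm_apply, Submodule.mem_one]
    have hyz : IsIntegral O (y * z) :=
      IsIntegral.mul hy (adjoin_le_integralClosure hxi hz)
    exact IsIntegrallyClosed.isIntegral_iff.mp (Algebra.isIntegral_trace (L := F) hyz)
  rw [traceForm_dualSubmodule_adjoin O F hx hxi] at hdual
  obtain ⟨w, hw, rfl⟩ := hdual
  have : Module.IsTorsionFree O L := .trans_faithfulSMul O F L
  obtain ⟨h, rfl⟩ := minpoly.isIntegrallyClosed_dvd hxi hfx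
  set g := minpoly O x with hg
  have hgx : aeval x g = 0 := minpoly.aeval O x
  have hF : aeval x (minpoly F x).derivative = aeval x g.derivative := by
    rw [minpoly.isIntegrallyClosed_eq_field_fractions' F hxi, derivative_map, aeval_map_algebraMap]
  -- As `f = g h` and `g(x) = 0`, `f'(x) = g'(x) h(x)`; so `g'(x)` is already a unit of `O[x]`.
  have h1 : (u * aeval x h) * aeval x g.derivative = 1 := by
    rw [← hux, derivative_mul, map_add, map_mul, map_mul, hgx]
    ring
  change (aeval x (minpoly F x).derivative)⁻¹ * w ∈ _
  rw [hF, ← eq_inv_of_mul_eq_one_left h1]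
  exact mul_mem (mul_mem hu (aeval_mem_adjoin_singleton O x)) hw

-- The differentials are generated by `dx`, and `f'(x) dx = 0` with `f'(x)` a unit.
open Polynomial in
theorem formallyUnramified_of_adjoin_of_isUnit_derivative {O B : Type*} [CommRing O] [CommRing B]
    [Algebra O B] {x : B} {f : O[X]} (hfx : aeval x f = 0)
    (hx : Algebra.adjoin O {x} = ⊤) (hu : IsUnit (aeval x f.derivative)) :
    Algebra.FormallyUnramified O B := by
  have hDx : KaehlerDifferential.D O B x = 0 := by
    have h := (KaehlerDifferential.D O B).map_aeval f x
    rw [hfx, map_zero] at h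
    exact (hu.smul_eq_zero).mp h.symm
  have hD (y : B) : KaehlerDifferential.D O B y = 0 := by
    have hy : y ∈ Algebra.adjoin O {x} := hx ▸ Algebra.mem_top
    rw [Algebra.adjoin_singleton_eq_range_aeval] at hy
    obtain ⟨p, rfl⟩ := hy
    exact ((KaehlerDifferential.D O B).map_aeval p x).trans (by rw [hDx, smul_zero])
  refine ⟨subsingleton_iff_forall_eq 0 |>.mpr fun ω ↦ ?_⟩
  have hω : ω ∈ Submodule.span B (Set.range (KaehlerDifferential.D O B)) :=
    KaehlerDifferential.span_range_derivation O B ▸ Submodule.mem_top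
  induction hω using Submodule.span_induction with
  | mem ω h => obtain ⟨y, rfl⟩ := h; exact hD y
  | zero => rfl
  | add _ _ _ _ h₁ h₂ => rw [h₁, h₂, add_zero]
  | smul b _ _ h => rw [h, smul_zero]

open Polynomial in
theorem formallyUnramified_integralClosure (O F : Type*) {L : Type u} [CommRing O]
    [Field F] [Field L] [Algebra O F] [Algebra F L] [Algebra O L] [IsScalarTower O F L]
    [IsDomain O] [IsFractionRing O F] [IsIntegrallyClosed O] [FiniteDimensional F L]
    [Algebra.IsSeparable F L] {x u : L} {f : O[X]} (hf : f.Monic) (hfx : aeval x f = 0)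
    (hx : Algebra.adjoin F {x} = ⊤) (hu : u ∈ Algebra.adjoin O {x})
    (hux : u * aeval x f.derivative = 1) :
    Algebra.FormallyUnramified O (integralClosure O L) := by
  have h := integralClosure_eq_adjoin_of_mul_derivative_eq_one O F hf hfx hx hu hux
  rw [h]
  let x' : Algebra.adjoin O {x} := ⟨x, Algebra.self_mem_adjoin_singleton O x⟩
  have hval (p : O[X]) : ((aeval x' p : Algebra.adjoin O {x}) : L) = aeval x p :=
    (aeval_algHom_apply (Algebra.adjoin O {x}).val x' p).symm
  refine formallyUnramified_of_adjoin_of_isUnit_derivative (x := x') (f := f)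
    (Subtype.ext ((hval f).trans hfx)) ?_
    (IsUnit.of_mul_eq_one_right ⟨u, hu⟩ (Subtype.ext ?_))
  · rw [eq_top_iff]
    rintro ⟨y, hy⟩ -
    rw [Algebra.adjoin_singleton_eq_range_aeval O x']
    obtain ⟨p, hp⟩ := (Algebra.adjoin_singleton_eq_range_aeval O x).le hy
    exact ⟨p, Subtype.ext ((hval p).trans hp)⟩
  · change u * ((aeval x' f.derivative : Algebra.adjoin O {x}) : L) = 1
    rw [hval, hux]

-- `M/K` is normal, so all conjugates of `θ` are polynomials in `θ`; hence `F(j θ)` is a splitting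
-- field of a separable polynomial.
open Polynomial in
theorem exists_galois_intermediateField {K F M : Type*} [Field K] [Field F] [Field M] [Algebra K F]
    [Algebra K M] [FiniteDimensional K M] [IsGalois K M] {θ : M}
    (hθ : IntermediateField.adjoin K {θ} = ⊤) :
    ∃ (L : IntermediateField F (AlgebraicClosure F)) (j : M →ₐ[K] L), FiniteDimensional F L ∧
      IsGalois F L ∧ Algebra.adjoin F {j θ} = ⊤ := by
  let Ω := AlgebraicClosure F
  let j : M →ₐ[K] Ω := IsAlgClosed.lift
  let p := minpoly K θ
  have hpi : IsIntegral K θ := Algebra.IsIntegral.isIntegral θ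
  have hsep : p.Separable := Algebra.IsSeparable.isSeparable K θ
  have hmem (m : M) : j m ∈ IntermediateField.adjoin F {j θ} := by
    have hm : m ∈ Algebra.adjoin K {θ} := by
      rw [← IntermediateField.adjoin_simple_toSubalgebra_of_isAlgebraic hpi.isAlgebraic, hθ]
      trivial
    rw [Algebra.adjoin_singleton_eq_range_aeval] at hm
    obtain ⟨q, rfl⟩ := hm
    change j (aeval θ q) ∈ _
    rw [← aeval_algHom_apply, ← aeval_map_algebraMap F]
    exact IntermediateField.algebra_adjoin_le_adjoin F _ (aeval_mem_adjoin_singleton F _)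
  have hroots : IntermediateField.adjoin F ((p.map (algebraMap K F)).rootSet Ω) =
      IntermediateField.adjoin F {j θ} := by
    apply le_antisymm
    · rw [IntermediateField.adjoin_le_iff]
      intro r hr
      have hr' := (mem_rootSet.mp hr).2
      rw [aeval_map_algebraMap] at hr'
      have hs : (p.map (algebraMap K M)).Splits := Normal.splits inferInstance θ
      have hr'' : r ∈ p.rootSet Ω := mem_rootSet.mpr ⟨minpoly.ne_zero hpi, hr'⟩
      rw [← hs.image_rootSet j] at hr''
      obtain ⟨m, -, rfl⟩ := hr''
      exact hmem m
    · rw [IntermediateField.adjoin_le_iff, Set.singleton_subset_iff]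
      refine IntermediateField.subset_adjoin F _ (mem_rootSet.mpr ⟨?_, ?_⟩)
      · exact ((minpoly.monic hpi).map _).ne_zero
      · rw [aeval_map_algebraMap, aeval_algHom_apply, minpoly.aeval, map_zero]
  let L := IntermediateField.adjoin F {j θ}
  have hsplit : (p.map (algebraMap K F)).IsSplittingField F L := by
    have := IntermediateField.adjoin_rootSet_isSplittingField
      (IsAlgClosed.splits ((p.map (algebraMap K F)).map (algebraMap F Ω)))
    rwa [hroots] at this
  refine ⟨L, j.codRestrict (L.restrictScalars K).toSubalgebra hmem,
    IsSplittingField.finiteDimensional L (p.map (algebraMap K F)),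
    IsGalois.of_separable_splitting_field (p := p.map (algebraMap K F)) hsep.map, ?_⟩
  rw [← IntermediateField.adjoin_eq_top_iff, ← IntermediateField.lift_inj,
    IntermediateField.lift_adjoin, IntermediateField.lift_top, Set.image_singleton]
  rfl

/-! ### Integrality at almost all places -/

namespace BrauerRamification

variable {K : Type u} [Field K]

theorem val_algebraMap_completion (v : Valuation K ℤᵐ⁰) (a : K) :
    (Valued.v : Valuation v.Completion ℤᵐ⁰) (algebraMap K v.Completion a) = v a :=
  Valued.valuedCompletion_apply (K := WithVal v) (WithVal.toVal v a)

theorem extVal_eq_zero (v : Valuation K ℤᵐ⁰) (L : IntermediateField v.Completion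
    (AlgebraicClosure v.Completion)) (a : Lˣ) (ha : IsIntegral (ComplInt v) (a : L))
    (ha' : IsIntegral (ComplInt v) ((a⁻¹ : Lˣ) : L)) : extVal v L a = 0 := by
  have key (x : L) (hx : IsIntegral (ComplInt v) x) :
      -- The norm of an integral element is integral; applied to `a` and `a⁻¹`, this forces the norm
      -- of `a` to be a unit.
      (Valued.v : Valuation v.Completion ℤᵐ⁰) (Algebra.norm v.Completion x) ≤ 1 := by
    obtain ⟨y, hy⟩ := IsIntegrallyClosed.isIntegral_iff.mp
      (Algebra.isIntegral_norm v.Completion hx)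
    rw [← hy]
    exact y.2
  have h : (Valued.v : Valuation v.Completion ℤᵐ⁰) (Algebra.norm v.Completion (a : L)) = 1 := by
    refine le_antisymm (key _ ha) ?_
    by_contra! hlt
    have h1 := mul_lt_one_of_lt_of_le hlt (key _ ha')
    rw [← map_mul, ← map_mul, Units.mul_inv, map_one, map_one] at h1
    exact lt_irrefl _ h1
  simp [extVal, h]

end BrauerRamification

namespace BrauerRamification

variable {K : Type u} [Field K]

open Polynomial in
theorem finite_setOf_not_integral_coeff {V : Set (Valuation K ℤᵐ⁰)}
    (hA : ∀ a : K, a ≠ 0 → {v ∈ V | v a ≠ 1}.Finite) {P : Set K[X]} (hP : P.Finite) :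
    {v ∈ V | ∃ q ∈ P, ∃ k, ¬ v (q.coeff k) ≤ 1}.Finite := by
  refine (hP.biUnion fun q _ ↦ q.support.finite_toSet.biUnion' (t := fun k _ ↦
    {v ∈ V | v (q.coeff k) ≠ 1}) fun k hk ↦ hA _ (mem_support_iff.mp hk)).subset ?_
  rintro v ⟨hv, q, hq, k, hk⟩
  simp only [Set.mem_iUnion]
  refine ⟨q, hq, k, mem_support_iff.mpr fun h ↦ hk (by simp [h]), hv, fun h ↦ hk h.le⟩

open Polynomial in
theorem map_mem_lifts_complInt {v : Valuation K ℤᵐ⁰} {q : K[X]} (hq : ∀ k, v (q.coeff k) ≤ 1) :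
    q.map (algebraMap K v.Completion) ∈ lifts (algebraMap (ComplInt v) v.Completion) := by
  rw [lifts_iff_coeff_lifts]
  intro k
  rw [coeff_map]
  exact ⟨⟨_, (val_algebraMap_completion v _).trans_le (hq k)⟩, rfl⟩

open Polynomial in
theorem exists_complInt_poly {v : Valuation K ℤᵐ⁰} {L : Type*} [Field L] [Algebra K L]
    [Algebra v.Completion L] [IsScalarTower K v.Completion L] {q : K[X]}
    (hq : ∀ k, v (q.coeff k) ≤ 1) :
    ∃ q' : (ComplInt v)[X], (q.Monic → q'.Monic) ∧
      (∀ x : L, aeval x q' = aeval x q) ∧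
      ∀ x : L, aeval x q'.derivative = aeval x q.derivative := by
  have key (q' : (ComplInt v)[X])
      (h : q'.map (algebraMap (ComplInt v) v.Completion) = q.map (algebraMap K v.Completion)) :
      (∀ x : L, aeval x q' = aeval x q) ∧
      ∀ x : L, aeval x q'.derivative = aeval x q.derivative :=
    ⟨fun x ↦ by rw [← aeval_map_algebraMap v.Completion, h, aeval_map_algebraMap],
      fun x ↦ by rw [← aeval_map_algebraMap v.Completion, ← derivative_map, h, derivative_map,
        aeval_map_algebraMap]⟩
  by_cases hm : q.Monic
  · obtain ⟨q', h, -, hq'⟩ := lifts_and_natDegree_eq_and_monic (map_mem_lifts_complInt hq) (hm.map _)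
    exact ⟨q', fun _ ↦ hq', key q' h⟩
  · obtain ⟨q', h⟩ := (mem_lifts _).mp (map_mem_lifts_complInt hq)
    exact ⟨q', fun h ↦ (hm h).elim, key q' h⟩

theorem isIntegral_complInt {v : Valuation K ℤᵐ⁰} {M L : Type*} [Field M] [Field L] [Algebra K M]
    [Algebra K L] [Algebra v.Completion L] [IsScalarTower K v.Completion L] [FiniteDimensional K M]
    (j : M →ₐ[K] L) {m : M} (hm : ∀ k, v ((minpoly K m).coeff k) ≤ 1) :
    IsIntegral (ComplInt v) (j m) := by
  obtain ⟨q, hq, hq', -⟩ := exists_complInt_poly (L := L) hm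
  refine ⟨q, hq (minpoly.monic (Algebra.IsIntegral.isIntegral m)), ?_⟩
  change Polynomial.aeval (j m) q = 0
  rw [hq', Polynomial.aeval_algHom_apply, minpoly.aeval, map_zero]

end BrauerRamification

/-! ### Finiteness of the ramification set -/

open BrauerRamification Polynomial in
theorem proposition2p1 {K : Type u} [Field K] (n : ℕ) (hn : 1 < n)
    (V : Set (Valuation K ℤᵐ⁰))
    (hV : ∀ v ∈ V, Function.Surjective v)
    (hA : ∀ a : K, a ≠ 0 → {v ∈ V | v a ≠ 1}.Finite)
    (hB : ∃ V' : Set (Valuation K ℤᵐ⁰), V' ⊆ V ∧ V'.Finite ∧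
      IsFractionRing (⨅ v ∈ V \ V', v.integer : Subring K) K)
    (hC : ∀ v ∈ V, (n : BrauerRamification.ResField v) ≠ 0)
    (α : BrauerGroup.{u, u} K) (hα : α ∈ BrauerRamification.torsionBr K n) :
    (BrauerRamification.Ram V n α).Finite := by
  obtain ⟨A, rfl⟩ := Quotient.exists_rep α
  obtain ⟨M, _, _, m, _, _, hm, ⟨φ⟩⟩ := exists_galois_splitting K A
  obtain ⟨b, hb⟩ := exists_hasCocycle hm φ
  obtain ⟨θ, hθ⟩ := Field.exists_primitive_element K M
  have hθi : IsIntegral K θ := Algebra.IsIntegral.isIntegral θ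
  obtain ⟨g, hg⟩ : ∃ g : K[X], aeval θ g * aeval θ (minpoly K θ).derivative = 1 := by
    have hne : aeval θ (minpoly K θ).derivative ≠ 0 :=
      (Algebra.IsSeparable.isSeparable K θ).aeval_derivative_ne_zero (minpoly.aeval K θ)
    have hmem : (aeval θ (minpoly K θ).derivative)⁻¹ ∈ Algebra.adjoin K {θ} := by
      rw [(IntermediateField.adjoin_simple_eq_top_iff_of_isAlgebraic hθi.isAlgebraic).mp hθ]
      trivial
    rw [Algebra.adjoin_singleton_eq_range_aeval] at hmem
    obtain ⟨g, hg⟩ := hmem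
    exact ⟨g, by rw [← AlgHom.coe_toRingHom] at hg; exact hg ▸ inv_mul_cancel₀ hne⟩
  -- All polynomials whose integrality at `v` is needed. The inverses appear because the cocycle
  -- values must be units, not merely integral.
  let P : Set K[X] := {minpoly K θ, g} ∪
    Set.range (fun s : (M ≃ₐ[K] M) × (M ≃ₐ[K] M) ↦ minpoly K (b s.1 s.2 : M)) ∪
    Set.range fun s : (M ≃ₐ[K] M) × (M ≃ₐ[K] M) ↦ minpoly K ((b s.1 s.2)⁻¹.val : M)
  have hP : P.Finite :=
    ((Set.toFinite _).union (Set.finite_range _)).union (Set.finite_range _)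
  refine (finite_setOf_not_integral_coeff hA hP).subset fun v ⟨hv, hram⟩ ↦ ⟨hv, ?_⟩
  by_contra! hint
  obtain ⟨L, j, hfin, hgal, hadj⟩ := exists_galois_intermediateField (F := v.Completion) hθ
  let : Algebra M L := j.toRingHom.toAlgebra
  have : IsScalarTower K M L := .of_algebraMap_eq fun x ↦ (j.commutes x).symm
  obtain ⟨f, hf, hf0, hf1⟩ := exists_complInt_poly (L := L) (hint (minpoly K θ) (by simp [P]))
  obtain ⟨g', -, hg', -⟩ := exists_complInt_poly (L := L) (hint g (by simp [P]))
  -- The cocycle has valuation zero, so the cochain `f = 0` bounds it and gives the trivial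
  -- character.
  refine hram ⟨A, L, _, 0, rfl, ⟨hfin, hgal, ?_⟩, hb.baseChange (F := v.Completion) (L := L),
    fun σ τ ↦ ?_, fun ι _ σ g _ ↦ ⟨0, by simp⟩⟩
  · refine formallyUnramified_integralClosure (ComplInt v) v.Completion
      (hf (minpoly.monic hθi)) (u := aeval (j θ) g') ?_ hadj
      (aeval_mem_adjoin_singleton _ _) ?_
    · rw [hf0, aeval_algHom_apply, minpoly.aeval, map_zero]
    · rw [hg', hf1, aeval_algHom_apply, aeval_algHom_apply, ← map_mul, hg, map_one]
  · rw [extVal_eq_zero]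
    · simp
    · exact isIntegral_complInt j (hint _ (.inl (.inr ⟨(_, _), rfl⟩)))
    · rw [← map_inv]
      exact isIntegral_complInt j (hint _ (.inr ⟨(_, _), rfl⟩))
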